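/- All graphs are finite and simple. The size of a path is its number of vertices, and $\log$ denotes the logarithm to base $2$. A $2$-tree is a graph obtained recursively as follows: a clique on two vertices is a $2$-tree, and if $G$ has a vertex $v$ of degree $2$ whose two neighbours are adjacent and $G\setminus v$ is a $2$-tree, then $G$ is a $2$-tree. A partial $2$-tree is any subgraph of a $2$-tree. A graph is $2$-connected if it has at least three vertices, is connected, and remains connected after the deletion of any single vertex. Theorem 2.4. Let $n\ge 4$ be an integer. If $G$ is a $2$-connected partial $2$-tree that contains a path on $n$ vertices, then $G$ contains an induced path on at least $\frac{\log (n-3)}{2}$ vertices. -/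

import Mathlib

universe u

namespace SimpleGraph

/-- A vertex is `k`-simplicial if it has degree `k` and its neighbourhood is a clique. -/
def IsKSimplicial {V : Type u} (G : SimpleGraph V) (k : ℕ) (v : V) : Prop :=
  (G.neighborSet v).encard = k ∧ G.IsClique (G.neighborSet v)

/-- The class of `k`-trees (for `k ≥ 1`), defined recursively: a clique on `k` vertices is a
`k`-tree, and if `G` has a `k`-simplicial vertex `v` such that `G - v` is a `k`-tree, then `G` is
a `k`-tree. Every `k`-tree is a finite graph. -/
inductive IsKTree (k : ℕ) : ∀ {V : Type u}, SimpleGraph V → Prop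
  | clique {V : Type u} (G : SimpleGraph V) (hcard : ENat.card V = k) (hG : G = ⊤) : IsKTree k G
  | step {V : Type u} (G : SimpleGraph V) (v : V) (hv : G.IsKSimplicial k v)
      (hG : IsKTree k (G.induce {v}ᶜ)) : IsKTree k G

/-- A partial `k`-tree is a graph that is (isomorphic to) a subgraph, not necessarily spanning or
induced, of a `k`-tree. -/
def IsPartialKTree {V : Type u} (G : SimpleGraph V) (k : ℕ) : Prop :=
  ∃ (W : Type u) (H : SimpleGraph W), H.IsKTree k ∧ G.IsContained H

/-- A graph is `2`-connected if it has at least three vertices, is connected, and remains connected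
after the deletion of any one vertex. -/
def IsTwoConnected {V : Type u} (G : SimpleGraph V) : Prop :=
  3 ≤ ENat.card V ∧ G.Connected ∧ ∀ v : V, (G.induce {v}ᶜ).Connected

/-- `G` contains a path on exactly `n` vertices. -/
def HasPathOfSize {V : Type u} (G : SimpleGraph V) (n : ℕ) : Prop :=
  ∃ (a b : V) (p : G.Walk a b), p.IsPath ∧ p.length + 1 = n

/-- `G` contains an induced path on exactly `m` vertices: a path such that every edge of `G`
between two of its vertices is an edge of the path. -/
def HasInducedPathOfSize {V : Type u} (G : SimpleGraph V) (m : ℕ) : Prop :=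
  ∃ (a b : V) (p : G.Walk a b), p.IsPath ∧ p.IsChordless ∧ p.length + 1 = m

end SimpleGraph

/-! Discard the vertices of the 2-tree outside `G`; the remaining 2-tree decomposes recursively over
a root edge `xy`: a triangle `xyz`, with 2-trees on `A`, `B`, `C` glued along `xz`, `zy`, `xy`
(`IsKTree.exists_twoTreeOn`).

Induct on this decomposition (`TwoTreeOn.exists_visits_le`), carrying a complexity `k` and induced
paths through `S` to `x` and to `y` with `d` and `e` edges, `k ≤ d + e`. Since `G - x` is connected,
an induced path through `A` to `z` continues through `B` to `y`, gaining an edge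
(`HasInducedPathTo.extend`); the same holds with the roles of `A, x` and `B, y` exchanged. Hence `k`
may be the maximum of `kA + 1`, `kB + 1` and `kC`.

Meanwhile the given path can enter and leave `S` only through `x` and `y`, so it meets `S` in few
stretches: at most one per end in `S`, plus one crossing. Each stretch accounts for at most `2 ^ k -
1` vertices, because passing `z` at most doubles the number of stretches and adds one vertex. At the
root this gives `n ≤ 2 + 3 * (2 ^ k - 1)`, while the longer induced path has at least `k / 2 + 1`
vertices. -/

namespace SimpleGraph

/-! ### Recursive decomposition of 2-trees -/

/-- `TwoTreeOn x y S E`: the set `E` of pairs is the edge set of a `2`-tree that has `s(x, y)` as an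
edge and whose remaining vertices form the set `S`. It is either the single edge, or has a vertex `z`
forming a triangle with `x` and `y`, with `2`-trees glued along the three edges of that triangle. -/
inductive TwoTreeOn {V : Type u} : V → V → Set V → Set (Sym2 V) → Prop
  | edge {x y : V} (h : x ≠ y) : TwoTreeOn x y ∅ {s(x, y)}
  | triangle {x y z : V} {A B C S : Set V} {E₁ E₂ E₃ E : Set (Sym2 V)}
      (hA : TwoTreeOn x z A E₁) (hB : TwoTreeOn z y B E₂) (hC : TwoTreeOn x y C E₃)
      (hz : z ∉ C) (hx : x ∉ B) (hy : y ∉ A)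
      (hAB : ∀ v ∈ A, v ∉ B) (hAC : ∀ v ∈ A, v ∉ C) (hBC : ∀ v ∈ B, v ∉ C)
      (hS : ∀ v, v ∈ S ↔ v = z ∨ v ∈ A ∨ v ∈ B ∨ v ∈ C)
      (hE : ∀ e, e ∈ E ↔ e ∈ E₁ ∨ e ∈ E₂ ∨ e ∈ E₃) : TwoTreeOn x y S E

namespace TwoTreeOn

variable {V : Type u} {x y : V} {S : Set V} {E : Set (Sym2 V)}

theorem ne_and_notMem (h : TwoTreeOn x y S E) : x ≠ y ∧ x ∉ S ∧ y ∉ S := by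
  induction h with
  | edge h => simp [h]
  | triangle => grind

theorem mem_of_mem_edges (h : TwoTreeOn x y S E) {a b : V} (hab : s(a, b) ∈ E) :
    a ∈ S ∨ a = x ∨ a = y := by
  induction h with
  | edge h =>
    simp only [Set.mem_singleton_iff, Sym2.eq_iff] at hab
    grind
  | triangle => grind

theorem exists_mem_edges (h : TwoTreeOn x y S E) {a : V} (ha : a = x ∨ a = y ∨ a ∈ S) :
    ∃ b, s(a, b) ∈ E := by
  induction h with
  | @edge x y h =>
    rcases ha with rfl | rfl | ha
    · exact ⟨y, rfl⟩
    · exact ⟨x, Sym2.eq_swap⟩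
    · exact ha.elim
  | triangle => grind

theorem map {W : Type u} {f : V → W} (hf : Function.Injective f) (h : TwoTreeOn x y S E) :
    TwoTreeOn (f x) (f y) (f '' S) (Sym2.map f '' E) := by
  induction h with
  | edge h => simpa using edge (hf.ne h)
  | triangle hA hB hC hz hx hy hAB hAC hBC hS hE ihA ihB ihC =>
    refine triangle ihA ihB ihC ?_ ?_ ?_ ?_ ?_ ?_ ?_ ?_
    · simpa [hf.eq_iff] using hz
    · simpa [hf.eq_iff] using hx
    · simpa [hf.eq_iff] using hy
    · rintro _ ⟨v, hv, rfl⟩; simpa [hf.eq_iff] using hAB v hv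
    · rintro _ ⟨v, hv, rfl⟩; simpa [hf.eq_iff] using hAC v hv
    · rintro _ ⟨v, hv, rfl⟩; simpa [hf.eq_iff] using hBC v hv
    · intro v; simp only [Set.mem_image, hS]; grind
    · intro e; simp only [Set.mem_image, hE]; grind

/-- Descend to the leaf of the decomposition that is the edge `ab` and replace it by a triangle with
apex `v`. -/
theorem insert {v a b : V} (h : TwoTreeOn x y S E) (hv : v ∉ S) (hvx : v ≠ x) (hvy : v ≠ y)
    (hab : s(a, b) ∈ E) :
    ∃ E', TwoTreeOn x y (Insert.insert v S) E' ∧ E ⊆ E' ∧ s(v, a) ∈ E' ∧ s(v, b) ∈ E' := by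
  induction h with
  | @edge x y h =>
    refine ⟨{s(x, v)} ∪ ({s(v, y)} ∪ {s(x, y)}), triangle (edge hvx.symm) (edge hvy) (edge h)
      (by simp) (by simp) (by simp) (by simp) (by simp) (by simp) (by simp)
      (fun e => by simp only [Set.mem_union]), ?_, ?_, ?_⟩
    · intro e he; simp_all
    all_goals
      simp only [Set.mem_singleton_iff, Sym2.eq_iff, Set.mem_union] at hab ⊢
      grind
  | @triangle x y z A B C S E₁ E₂ E₃ E hA hB hC hz hx hy hAB hAC hBC hS hE ihA ihB ihC =>
    have nA := hA.ne_and_notMem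
    have nB := hB.ne_and_notMem
    simp only [hS, not_or] at hv
    obtain ⟨hvz, hvA, hvB, hvC⟩ := hv
    rcases (hE _).1 hab with h | h | h
    · obtain ⟨E', h1, h2, h3, h4⟩ := ihA hvA hvx hvz h
      exact ⟨E' ∪ (E₂ ∪ E₃), triangle h1 hB hC hz hx (by grind) (by grind) (by grind) (by grind)
        (by grind) (by simp), by grind, by grind, by grind⟩
    · obtain ⟨E', h1, h2, h3, h4⟩ := ihB hvB hvz hvy h
      exact ⟨E₁ ∪ (E' ∪ E₃), triangle hA h1 hC hz (by grind) hy (by grind) (by grind) (by grind)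
        (by grind) (by simp), by grind, by grind, by grind⟩
    · obtain ⟨E', h1, h2, h3, h4⟩ := ihC hvC hvx hvy h
      exact ⟨E₁ ∪ (E₂ ∪ E'), triangle hA hB h1 (by grind) hx hy (by grind) (by grind) (by grind)
        (by grind) (by simp), by grind, by grind, by grind⟩

end TwoTreeOn

/-- The injection `f` lets the induction pass to fewer vertices, so the decomposition uses vertices
of `V` only. Extra edges are harmless. -/
theorem IsKTree.exists_twoTreeOn {W : Type u} {H : SimpleGraph W} (h : H.IsKTree 2) :
    ∀ {V : Type u} (f : V → W), Function.Injective f → Nontrivial V →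
      ∃ x y S E, TwoTreeOn x y S E ∧ (∀ v : V, v = x ∨ v = y ∨ v ∈ S) ∧
        ∀ a b, H.Adj (f a) (f b) → s(a, b) ∈ E := by
  induction h with
  | @clique W H hcard hG =>
    intro V f hf hV
    obtain ⟨x, y, hxy⟩ := exists_pair_ne V
    have hW : Nat.card W = 2 := by simp [Nat.card, ENat.card] at hcard ⊢; simp [hcard]
    obtain ⟨c, d, hcd, hu⟩ := Nat.card_eq_two_iff.1 hW
    have hmem : ∀ w : W, w = c ∨ w = d := fun w => by
      have : w ∈ ({c, d} : Set W) := hu ▸ Set.mem_univ w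
      simpa using this
    have key : ∀ v : V, v = x ∨ v = y := fun v => by
      have := hf.ne hxy
      rcases hmem (f v) with h | h <;> rcases hmem (f x) with h' | h' <;>
        rcases hmem (f y) with h'' | h'' <;> grind [Function.Injective]
    refine ⟨x, y, ∅, _, .edge hxy, fun v => by simpa using key v, fun a b hab => ?_⟩
    have hne : a ≠ b := fun h => hab.ne (congrArg f h)
    simp only [Set.mem_singleton_iff, Sym2.eq_iff]
    rcases key a with ha | ha <;> rcases key b with hb | hb <;> grind
  | @step W H v hv hG ih =>
    intro V f hf hV
    by_cases hvf : v ∈ Set.range f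
    swap
    · obtain ⟨x, y, S, E, h1, h2, h3⟩ := ih (fun a => ⟨f a, fun h => hvf ⟨a, h⟩⟩)
        (fun a b hab => hf (congrArg Subtype.val hab)) hV
      exact ⟨x, y, S, E, h1, h2, fun a b hab => h3 a b (by simpa using hab)⟩
    obtain ⟨u, rfl⟩ := hvf
    by_cases hV' : Nontrivial {w : V // w ≠ u}
    swap
    · obtain ⟨u', hu'⟩ := exists_ne u
      have key : ∀ w, w ≠ u → w = u' := fun w hw =>
        congrArg Subtype.val ((not_nontrivial_iff_subsingleton.1 hV').elim ⟨w, hw⟩ ⟨u', hu'⟩)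
      refine ⟨u, u', ∅, _, .edge hu'.symm, fun w => by by_cases hw : w = u <;> simp_all,
        fun a b hab => ?_⟩
      have hne : a ≠ b := fun h => hab.ne (congrArg f h)
      have key' : ∀ w, w = u ∨ w = u' := fun w => or_iff_not_imp_left.2 (key w)
      simp only [Set.mem_singleton_iff, Sym2.eq_iff]
      rcases key' a with ha | ha <;> rcases key' b with hb | hb <;> grind
    obtain ⟨x, y, S, E, h1, h2, h3⟩ := ih (V := {w : V // w ≠ u})
      (fun a => ⟨f a, fun h => a.2 (hf h)⟩)
      (fun a b hab => Subtype.ext (hf (congrArg Subtype.val hab))) hV'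
    have h3' : ∀ a b : {w : V // w ≠ u}, H.Adj (f a) (f b) → s(a, b) ∈ E := fun a b hab =>
      h3 a b (by simpa using hab)
    -- An edge covering all neighbours of `u` in `V`: the simplicial clique if both survive,
    -- otherwise any edge at the surviving neighbour, or any edge at all.
    have hpair : ∃ a b : {w : V // w ≠ u}, s(a, b) ∈ E ∧
        ∀ w, H.Adj (f u) (f w) → w = a.1 ∨ w = b.1 := by
      obtain ⟨c, d, hcd, hN⟩ := Set.encard_eq_two.1 hv.1
      have hN' : ∀ w, H.Adj (f u) (f w) → f w = c ∨ f w = d := fun w hw => by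
        have : f w ∈ H.neighborSet (f u) := hw
        simpa [hN] using this
      by_cases hex : ∃ a b, a ≠ b ∧ H.Adj (f u) (f a) ∧ H.Adj (f u) (f b)
      · obtain ⟨a, b, hab, ha, hb⟩ := hex
        have hau : a ≠ u := by rintro rfl; exact ha.ne rfl
        have hbu : b ≠ u := by rintro rfl; exact hb.ne rfl
        refine ⟨⟨a, hau⟩, ⟨b, hbu⟩, h3' _ _ (hv.2 ha hb (hf.ne hab)), fun w hw => ?_⟩
        have := hf.ne hab
        have e1 := hN' a ha
        have e2 := hN' b hb
        have e3 := hN' w hw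
        have i1 := @hf w a
        have i2 := @hf w b
        grind
      · by_cases hex' : ∃ a, H.Adj (f u) (f a)
        · obtain ⟨a, ha⟩ := hex'
          have hau : a ≠ u := by rintro rfl; exact ha.ne rfl
          obtain ⟨b, hb⟩ := h1.exists_mem_edges (h2 ⟨a, hau⟩)
          exact ⟨_, b, hb, fun w hw => by grind⟩
        · obtain ⟨b, hb⟩ := h1.exists_mem_edges (h2 x)
          exact ⟨_, b, hb, fun w hw => by grind⟩
    obtain ⟨a, b, hab, hw⟩ := hpair
    obtain ⟨E', g1, g2, g3, g4⟩ := (h1.map Subtype.val_injective).insert (v := u) (a := a.1)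
      (b := b.1) (by simp) x.2.symm y.2.symm ⟨_, hab, rfl⟩
    refine ⟨x, y, _, E', g1, fun w => ?_, fun c d hcd => ?_⟩
    · by_cases hwu : w = u
      · simp [hwu]
      · rcases h2 ⟨w, hwu⟩ with h | h | h
        · exact .inl (congrArg Subtype.val h)
        · exact .inr (.inl (congrArg Subtype.val h))
        · exact .inr (.inr (.inr ⟨_, h, rfl⟩))
    · by_cases hc : c = u
      · subst hc
        rcases hw d hcd with rfl | rfl <;> assumption
      · by_cases hd : d = u
        · subst hd
          rw [Sym2.eq_swap]
          rcases hw c hcd.symm with rfl | rfl <;> assumption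
        · exact g2 ⟨_, h3' ⟨c, hc⟩ ⟨d, hd⟩ hcd, rfl⟩

end SimpleGraph
-- Induced paths and their extension
namespace SimpleGraph

variable {V : Type u} {G : SimpleGraph V}

/-- The vertices `q 0, …, q d` are distinct and induce in `G` exactly the path `q 0 - ⋯ - q d`. -/
def IsInducedSeq (G : SimpleGraph V) (q : ℕ → V) (d : ℕ) : Prop :=
  (∀ i j, i < j → j ≤ d → q i ≠ q j) ∧ ∀ i j, i < j → j ≤ d → (G.Adj (q i) (q j) ↔ j = i + 1)

theorem IsInducedSeq.mono {q : ℕ → V} {d e : ℕ} (h : G.IsInducedSeq q d) (hed : e ≤ d) :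
    G.IsInducedSeq q e :=
  ⟨fun i j hij hj => h.1 i j hij (hj.trans hed), fun i j hij hj => h.2 i j hij (hj.trans hed)⟩

/-- Cutting the path at the first neighbour of `w` before appending `w` leaves no chord. -/
theorem IsInducedSeq.snoc {q : ℕ → V} {d j : ℕ} {w : V} (h : G.IsInducedSeq q d)
    (hw : ∀ i ≤ d, q i ≠ w) (hj : j ≤ d) (hjw : G.Adj (q j) w) (hmin : ∀ i < j, ¬ G.Adj (q i) w) :
    G.IsInducedSeq (Function.update q (j + 1) w) (j + 1) := by
  refine ⟨fun a b hab hb => ?_, fun a b hab hb => ?_⟩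
  · rw [Function.update_of_ne (by omega : a ≠ j + 1)]
    by_cases hbj : b = j + 1
    · subst hbj
      simpa using hw a (by omega)
    · rw [Function.update_of_ne hbj]
      exact h.1 a b hab (by omega)
  · rw [Function.update_of_ne (by omega : a ≠ j + 1)]
    by_cases hbj : b = j + 1
    · subst hbj
      rw [Function.update_self]
      rcases Nat.lt_or_ge a j with haj | haj
      · exact iff_of_false (hmin a haj) (by omega)
      · obtain rfl : a = j := by omega
        exact iff_of_true hjw rfl
    · rw [Function.update_of_ne hbj]
      exact h.2 a b hab (by omega)

theorem exists_walk_of_adj {q : ℕ → V} {d : ℕ} (h : ∀ i < d, G.Adj (q i) (q (i + 1))) :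
    ∃ w : G.Walk (q 0) (q d), w.length = d ∧ ∀ i ≤ d, w.getVert i = q i := by
  induction d with
  | zero => exact ⟨.nil, rfl, fun i hi => by rw [Nat.le_zero.1 hi]; rfl⟩
  | succ d ih =>
    obtain ⟨w, hw, hq⟩ := ih fun i hi => h i (by omega)
    refine ⟨w.concat (h d (by omega)), by simp [hw], fun i hi => ?_⟩
    rcases Nat.lt_or_ge d i with hd | hd
    · obtain rfl : i = d + 1 := by omega
      exact Walk.getVert_of_length_le _ (by simp [hw])
    · rw [Walk.concat_eq_append, Walk.getVert_append]
      split_ifs with hlt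
      · exact hq i hd
      · obtain rfl : i = d := by omega
        simp [hw]

theorem IsInducedSeq.hasInducedPathOfSize {q : ℕ → V} {d : ℕ} (h : G.IsInducedSeq q d) :
    G.HasInducedPathOfSize (d + 1) := by
  obtain ⟨w, hw, hq⟩ := exists_walk_of_adj (G := G) (q := q) (d := d)
    fun i hi => (h.2 i (i + 1) (by omega) (by omega)).2 rfl
  refine ⟨_, _, w, (Walk.IsPath.getVert_injOn_iff w).1 ?_, ?_, by rw [hw]⟩
  · intro i hi j hj hij
    simp only [hw] at hi hj
    rw [hq i hi, hq j hj] at hij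
    rcases lt_trichotomy i j with hlt | rfl | hlt
    · exact (h.1 i j hlt hj hij).elim
    · rfl
    · exact (h.1 j i hlt hi hij.symm).elim
  · rw [← Walk.isInduced_toSubgraph]
    intro a ha b hb hab
    rw [Walk.mem_verts_toSubgraph, Walk.mem_support_iff_exists_getVert] at ha hb
    obtain ⟨i, rfl, hi⟩ := ha
    obtain ⟨j, rfl, hj⟩ := hb
    rw [hw] at hi hj
    rw [hq i hi, hq j hj] at hab
    rcases lt_trichotomy i j with hlt | rfl | hlt
    · obtain rfl := (h.2 i j hlt hj).1 hab
      exact w.toSubgraph_adj_getVert (by omega)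
    · exact (hab.ne rfl).elim
    · obtain rfl := (h.2 j i hlt hi).1 hab.symm
      exact (w.toSubgraph_adj_getVert (by omega)).symm

theorem mem_of_connected_of_closed {x y z : V} (hconn : (G.induce {x}ᶜ).Connected) (hzx : z ≠ x)
    (hyx : y ≠ x) {U : Set V} (hz : z ∈ U)
    (hU : ∀ u ∈ U, u ≠ x → ∀ w, w ≠ x → G.Adj u w → w ∈ U) : y ∈ U := by
  obtain ⟨p⟩ := hconn.preconnected ⟨z, hzx⟩ ⟨y, hyx⟩
  have key : ∀ {a b : ({x}ᶜ : Set V)}, (G.induce {x}ᶜ).Walk a b → a.1 ∈ U → b.1 ∈ U := by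
    intro a b p
    induction p with
    | nil => exact id
    | @cons a c b h p ih => exact fun ha => ih (hU a ha a.2 c c.2 h)
  exact key p hz

/-- There is an induced path with `d` edges that ends in `x` and has all other vertices in `S`. -/
def HasInducedPathTo (G : SimpleGraph V) (x : V) (S : Set V) (d : ℕ) : Prop :=
  ∃ q : ℕ → V, G.IsInducedSeq q d ∧ q d = x ∧ ∀ i < d, q i ∈ S

theorem HasInducedPathTo.mono {x : V} {S T : Set V} {d : ℕ} (h : G.HasInducedPathTo x S d)
    (hST : ∀ v ∈ S, v ∈ T) : G.HasInducedPathTo x T d :=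
  let ⟨q, h1, h2, h3⟩ := h
  ⟨q, h1, h2, fun i hi => hST _ (h3 i hi)⟩

/-- Grow induced paths from `z` into `B`, keeping their part in `A`. Connectedness of `G - x` forces
one of them to reach `y`. -/
theorem HasInducedPathTo.extend {x y z : V} {A B S : Set V} {d : ℕ}
    (hconn : (G.induce {x}ᶜ).Connected) (hzx : z ≠ x) (hyx : y ≠ x) (hyz : y ≠ z)
    (hA : ∀ a ∈ A, ∀ b, G.Adj a b → b ∈ A ∨ b = x ∨ b = z)
    (hz : ∀ b, G.Adj z b → b ∈ A ∨ b = x ∨ b ∈ B ∨ b = y)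
    (hB : ∀ a ∈ B, ∀ b, G.Adj a b → b ∈ B ∨ b = z ∨ b = y)
    (hyA : y ∉ A) (hS : ∀ v, v = z ∨ v ∈ A ∨ v ∈ B → v ∈ S) (h : G.HasInducedPathTo z A d) :
    ∃ d' > d, G.HasInducedPathTo y S d' := by
  obtain ⟨q₀, hq₀, hq₀z, hq₀A⟩ := h
  -- `R` collects the ends of such continuations. If `y ∉ R`, then `A ∪ R` is closed under adjacency
  -- in `G - x`, so it contains `y`, a contradiction.
  let R : Set V := {w | ∃ (q : ℕ → V) (k : ℕ), d ≤ k ∧ G.IsInducedSeq q k ∧ q k = w ∧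
    (∀ i < d, q i ∈ A) ∧ q d = z ∧ ∀ i, d < i → i ≤ k → q i ∈ B ∨ q i = y}
  have hR : y ∈ R := by
    by_contra hyR
    have hmem : y ∈ A ∪ R := by
      refine mem_of_connected_of_closed hconn hzx hyx
        (.inr ⟨q₀, d, le_rfl, hq₀, hq₀z, hq₀A, hq₀z, fun i h1 h2 => by omega⟩) ?_
      rintro u (hu | ⟨q, k, hdk, hq, rfl, hqA, hqz, hqB⟩) hux w hwx huw
      · rcases hA u hu w huw with h | h | h
        · exact .inl h
        · exact (hwx h).elim
        · subst h
          exact .inr ⟨q₀, d, le_rfl, hq₀, hq₀z, hq₀A, hq₀z, fun i h1 h2 => by omega⟩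
      · by_cases hwA : w ∈ A
        · exact .inl hwA
        refine .inr ?_
        by_cases hex : ∃ i ≤ k, q i = w
        · obtain ⟨i, hi, rfl⟩ := hex
          have hdi : d ≤ i := by
            by_contra hdi
            exact hwA (hqA i (by omega))
          exact ⟨q, i, hdi, hq.mono hi, rfl, hqA, hqz, fun j h1 h2 => hqB j h1 (h2.trans hi)⟩
        · push Not at hex
          have hwz : w ≠ z := fun h => hex d hdk (hqz.trans h.symm)
          have hwB : w ∈ B ∨ w = y := by
            rcases hdk.eq_or_lt with rfl | hlt
            · have := hz w (hqz ▸ huw)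
              tauto
            · rcases hqB k hlt le_rfl with h | h
              · have := hB _ h w huw
                tauto
              · exact (hyR ⟨q, k, hdk, hq, h, hqA, hqz, hqB⟩).elim
          classical
          -- The first neighbour of `w` has index at least `d`, since `w` lies outside `A ∪ {x, z}`;
          -- the initial part of the path is thus kept.
          have hadj : ∃ i, G.Adj (q i) w := ⟨k, huw⟩
          have hle : Nat.find hadj ≤ k := Nat.find_min' hadj huw
          have hge : d ≤ Nat.find hadj := by
            by_contra hlt
            have := hA _ (hqA _ (not_le.1 hlt)) w (Nat.find_spec hadj)
            tauto
          refine ⟨_, _, by omega, hq.snoc hex hle (Nat.find_spec hadj)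
            fun i hi => Nat.find_min hadj hi, by simp, fun i hi => ?_, ?_, fun i h1 h2 => ?_⟩
          · rw [Function.update_of_ne (by omega)]
            exact hqA i hi
          · rw [Function.update_of_ne (by omega)]
            exact hqz
          · by_cases hi : i = Nat.find hadj + 1
            · subst hi
              simpa using hwB
            · rw [Function.update_of_ne hi]
              exact hqB i h1 (by omega)
    exact hmem.elim hyA hyR
  obtain ⟨q, k, hdk, hq, hqy, hqA, hqz, hqB⟩ := hR
  have hlt : d < k := lt_of_le_of_ne hdk fun h => hyz (by rw [← hqy, ← h, hqz])
  refine ⟨k, hlt, q, hq, hqy, fun i hi => hS _ ?_⟩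
  rcases lt_trichotomy i d with h | rfl | h
  · exact .inr (.inl (hqA i h))
  · exact .inl hqz
  · rcases hqB i h hi.le with h' | h'
    · exact .inr (.inr h')
    · exact (hq.1 i k hi le_rfl (h'.trans hqy.symm)).elim

end SimpleGraph
-- Counting visits of a path
namespace SimpleGraph

variable {V : Type u}

/-- The sequence `p 0, …, p L` contains a segment that joins `x` and `y` and has at least one inner
vertex, all inner vertices lying in `S`. -/
def Crosses (p : ℕ → V) (L : ℕ) (x y : V) (S : Set V) : Prop :=
  ∃ i j, i + 1 < j ∧ j ≤ L ∧ (p i = x ∧ p j = y ∨ p i = y ∧ p j = x) ∧ ∀ k, i < k → k < j → p k ∈ S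

section Counting

open Classical in
/-- The number of indices `i ≤ L` with `p i ∈ S`. -/
noncomputable def visits (p : ℕ → V) (L : ℕ) (S : Set V) : ℕ :=
  ((Finset.range (L + 1)).filter fun i => p i ∈ S).card

open Classical in
/-- The number of ends of the sequence `p 0, …, p L` that lie in `S`. -/
noncomputable def endsIn (p : ℕ → V) (L : ℕ) (S : Set V) : ℕ :=
  (if p 0 ∈ S then 1 else 0) + (if p L ∈ S then 1 else 0)

open Classical in
/-- The indicator of `Crosses p L x y S`. -/
noncomputable def crossings (p : ℕ → V) (L : ℕ) (x y : V) (S : Set V) : ℕ :=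
  if Crosses p L x y S then 1 else 0

end Counting

variable {p : ℕ → V} {L : ℕ} {x y z : V} {A B C S : Set V}

theorem visits_union_le (h : ∀ v ∈ S, v ∈ A ∨ v ∈ B) :
    visits p L S ≤ visits p L A + visits p L B := by
  classical
  unfold visits
  refine le_trans (Finset.card_le_card fun i hi => ?_) (Finset.card_union_le _ _)
  simp only [Finset.mem_filter, Finset.mem_union] at hi ⊢
  have := h _ hi.2
  tauto

theorem visits_eq_zero (h : ∀ i ≤ L, p i ∉ S) : visits p L S = 0 := by
  classical
  refine Finset.card_eq_zero.2 (Finset.filter_eq_empty_iff.2 fun i hi => h i ?_)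
  have := Finset.mem_range.1 hi
  omega

theorem visits_singleton_le (hp : Set.InjOn p (Set.Iic L)) : visits p L {z} ≤ 1 := by
  classical
  refine Finset.card_le_one.2 fun i hi j hj => ?_
  simp only [Finset.mem_filter, Finset.mem_range, Set.mem_singleton_iff] at hi hj
  exact hp (show i ≤ L by omega) (show j ≤ L by omega) (hi.2.trans hj.2.symm)

theorem Crosses.symm (h : Crosses p L x y S) : Crosses p L y x S :=
  let ⟨i, j, h1, h2, h3, h4⟩ := h
  ⟨i, j, h1, h2, h3.symm, h4⟩

theorem Crosses.mono (h : Crosses p L x y A) (hAS : ∀ v ∈ A, v ∈ S) : Crosses p L x y S :=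
  let ⟨i, j, h1, h2, h3, h4⟩ := h
  ⟨i, j, h1, h2, h3, fun k h h' => hAS _ (h4 k h h')⟩

/-- By injectivity both segments have the same end indices, so they share an inner vertex. -/
theorem not_crosses_both (hp : Set.InjOn p (Set.Iic L)) (hAB : ∀ v ∈ A, v ∉ B)
    (hA : Crosses p L x y A) (hB : Crosses p L x y B) : False := by
  obtain ⟨i, j, h1, h2, h3, h4⟩ := hA
  obtain ⟨i', j', h1', h2', h3', h4'⟩ := hB
  have hinj : ∀ a b, a ≤ L → b ≤ L → p a = p b → a = b := fun a b ha hb h => hp ha hb h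
  have e1 := hinj i i' (by omega) (by omega)
  have e2 := hinj j j' (by omega) (by omega)
  have e3 := hinj i j' (by omega) (by omega)
  have e4 := hinj j i' (by omega) (by omega)
  have hi : i = i' := by
    rcases h3 with ⟨a, b⟩ | ⟨a, b⟩ <;> rcases h3' with ⟨a', b'⟩ | ⟨a', b'⟩ <;> simp_all <;> omega
  subst hi
  exact hAB _ (h4 (i + 1) (by omega) h1) (h4' (i + 1) (by omega) h1')

/-- Crossings over `x, z` and over `z, y` combine to a crossing over `x, y`. -/
theorem Crosses.trans (hp : Set.InjOn p (Set.Iic L)) (hAB : ∀ v ∈ A, v ∉ B)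
    (hS : ∀ v, v = z ∨ v ∈ A ∨ v ∈ B → v ∈ S)
    (hA : Crosses p L x z A) (hB : Crosses p L z y B) : Crosses p L x y S := by
  obtain ⟨i, j, h1, h2, h3, h4⟩ := hA
  obtain ⟨i', j', h1', h2', h3', h4'⟩ := hB
  have hinj : ∀ a b, a ≤ L → b ≤ L → p a = p b → a = b := fun a b ha hb h => hp ha hb h
  rcases h3 with ⟨a, b⟩ | ⟨a, b⟩ <;> rcases h3' with ⟨a', b'⟩ | ⟨a', b'⟩
  · obtain rfl := hinj j i' (by omega) (by omega) (b.trans a'.symm)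
    refine ⟨i, j', by omega, h2', .inl ⟨a, b'⟩, fun k hk hk' => hS _ ?_⟩
    rcases lt_trichotomy k j with h | rfl | h
    · exact .inr (.inl (h4 k hk h))
    · exact .inl b
    · exact .inr (.inr (h4' k h hk'))
  · obtain rfl := hinj j j' (by omega) (by omega) (b.trans b'.symm)
    exact (hAB _ (h4 (j - 1) (by omega) (by omega)) (h4' (j - 1) (by omega) (by omega))).elim
  · obtain rfl := hinj i i' (by omega) (by omega) (a.trans a'.symm)
    exact (hAB _ (h4 (i + 1) (by omega) (by omega)) (h4' (i + 1) (by omega) (by omega))).elim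
  · obtain rfl := hinj i j' (by omega) (by omega) (a.trans b'.symm)
    refine ⟨i', j, by omega, h2, .inr ⟨a', b⟩, fun k hk hk' => hS _ ?_⟩
    rcases lt_trichotomy k i with h | rfl | h
    · exact .inr (.inr (h4' k hk h))
    · exact .inl a
    · exact .inr (.inl (h4 k h hk'))

theorem not_crosses_of_forall_ne (h : ∀ i ≤ L, p i ≠ z) : ¬ Crosses p L x z A := by
  rintro ⟨i, j, h1, h2, h3, -⟩
  rcases h3 with ⟨-, h3⟩ | ⟨h3, -⟩
  · exact h j h2 h3
  · exact h i (by omega) h3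

/-- A path that visits a set attached only at `x` and `y` ends there or crosses it. -/
theorem crosses_of_mem {G : SimpleGraph V} (hp : Set.InjOn p (Set.Iic L))
    (hadj : ∀ i < L, G.Adj (p i) (p (i + 1)))
    (hS : ∀ a ∈ S, ∀ b, G.Adj a b → b ∈ S ∨ b = x ∨ b = y)
    {k : ℕ} (hk : k ≤ L) (hkS : p k ∈ S) (h0 : p 0 ∉ S) (hL : p L ∉ S) : Crosses p L x y S := by
  classical
  have hinj : ∀ a b, a ≤ L → b ≤ L → p a = p b → a = b := fun a b ha hb h => hp ha hb h
  set i := Nat.findGreatest (fun i => p i ∉ S) k with hi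
  have hiS : p i ∉ S := Nat.findGreatest_spec (P := fun i => p i ∉ S) (Nat.zero_le k) h0
  have hik : i ≤ k := Nat.findGreatest_le k
  have hik' : i < k := lt_of_le_of_ne hik fun h => hiS (h ▸ hkS)
  have himax : ∀ a, i < a → a ≤ k → p a ∈ S := fun a h h' =>
    not_not.1 (Nat.findGreatest_is_greatest (P := fun i => p i ∉ S) h h')
  have hex : ∃ j, k < j ∧ p j ∉ S := ⟨L, lt_of_le_of_ne hk fun h => hL (h ▸ hkS), hL⟩
  set j := Nat.find hex with hj
  obtain ⟨hkj, hjS⟩ : k < j ∧ p j ∉ S := Nat.find_spec hex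
  have hjL : j ≤ L := Nat.find_min' hex ⟨lt_of_le_of_ne hk fun h => hL (h ▸ hkS), hL⟩
  have hjmin : ∀ a, k < a → a < j → p a ∈ S := fun a h h' => by
    by_contra hc
    exact Nat.find_min hex h' ⟨h, hc⟩
  have hall : ∀ a, i < a → a < j → p a ∈ S := fun a h h' => by
    rcases Nat.lt_or_ge k a with hka | hka
    · exact hjmin a hka h'
    · exact himax a h hka
  have hi' := hS _ (hall (i + 1) (by omega) (by omega)) _ (hadj i (by omega)).symm
  have hj' := hS _ (hall (j - 1) (by omega) (by omega)) (p j) (by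
    have := hadj (j - 1) (by omega)
    rwa [Nat.sub_add_cancel (by omega)] at this)
  have hne : p i ≠ p j := fun h => by
    have := hinj i j (by omega) hjL h
    omega
  refine ⟨i, j, by omega, hjL, ?_, hall⟩
  grind

theorem crossings_add_le (hp : Set.InjOn p (Set.Iic L)) (hAC : ∀ v ∈ A, v ∉ C)
    (hAS : ∀ v ∈ A, v ∈ S) (hCS : ∀ v ∈ C, v ∈ S) :
    crossings p L x y A + crossings p L x y C ≤ crossings p L x y S := by
  unfold crossings
  have h1 : Crosses p L x y A → Crosses p L x y S := fun h => h.mono hAS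
  have h2 : Crosses p L x y C → Crosses p L x y S := fun h => h.mono hCS
  have h3 := not_crosses_both (x := x) (y := y) hp hAC
  split_ifs <;> simp_all

theorem endsIn_add_le (hAB : ∀ v ∈ A, v ∉ B) (hAS : ∀ v ∈ A, v ∈ S) (hBS : ∀ v ∈ B, v ∈ S) :
    endsIn p L A + endsIn p L B ≤ endsIn p L S := by
  unfold endsIn
  have a0 := hAB (p 0)
  have a1 := hAS (p 0)
  have a2 := hBS (p 0)
  have b0 := hAB (p L)
  have b1 := hAS (p L)
  have b2 := hBS (p L)
  split_ifs <;> simp_all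

/-- If the path misses `z`, it crosses neither `A` nor `B`, and only its ends count. Otherwise the
stretches in `A` and `B` number at most twice those in `S`, and `z` itself costs one more: hence `2
* M + 1`. -/
theorem visits_series_le {G : SimpleGraph V} (hp : Set.InjOn p (Set.Iic L))
    (hadj : ∀ i < L, G.Adj (p i) (p (i + 1)))
    (hS : ∀ a ∈ S, ∀ b, G.Adj a b → b ∈ S ∨ b = x ∨ b = y)
    (hSiff : ∀ v, v ∈ S ↔ v = z ∨ v ∈ A ∨ v ∈ B)
    (hAB : ∀ v ∈ A, v ∉ B) {M N : ℕ} (hMN : 2 * M + 1 ≤ N)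
    (hA : visits p L A ≤ (endsIn p L A + crossings p L x z A) * M)
    (hB : visits p L B ≤ (endsIn p L B + crossings p L z y B) * M) :
    visits p L S ≤ (endsIn p L S + crossings p L x y S) * N := by
  have hAS : ∀ v ∈ A, v ∈ S := fun v hv => (hSiff v).2 (.inr (.inl hv))
  have hBS : ∀ v ∈ B, v ∈ S := fun v hv => (hSiff v).2 (.inr (.inr hv))
  have hsub : visits p L S ≤ visits p L {z} + (visits p L A + visits p L B) := by
    refine (visits_union_le (A := {z}) (B := A ∪ B) fun v hv => (hSiff v).1 hv).trans ?_
    gcongr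
    exact visits_union_le fun v hv => hv
  by_cases hz : ∃ i ≤ L, p i = z
  · obtain ⟨k, hk, hkz⟩ := hz
    have hz1 := visits_singleton_le (z := z) hp
    have hpos : 1 ≤ endsIn p L S + crossings p L x y S := by
      by_cases h0 : p 0 ∈ S
      · simp [endsIn, h0]; omega
      by_cases hL : p L ∈ S
      · simp [endsIn, hL]; omega
      · have := crosses_of_mem hp hadj hS hk ((hSiff _).2 (.inl hkz)) h0 hL
        simp [crossings, this]
    -- Two crossings combine into one of `S`; a single crossing is absorbed by `hpos`.
    have htwo : endsIn p L A + crossings p L x z A + (endsIn p L B + crossings p L z y B) ≤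
        2 * (endsIn p L S + crossings p L x y S) := by
      have c1 := Crosses.trans (x := x) (y := y) hp hAB (fun v => (hSiff v).2)
      have hcS : Crosses p L x z A → Crosses p L z y B → crossings p L x y S = 1 :=
        fun h h' => by simp [crossings, c1 h h']
      have hends := endsIn_add_le (p := p) (L := L) hAB hAS hBS
      have h1 : crossings p L x z A ≤ 1 := by unfold crossings; split_ifs <;> simp
      have h2 : crossings p L z y B ≤ 1 := by unfold crossings; split_ifs <;> simp
      by_cases hX : Crosses p L x z A ∧ Crosses p L z y B
      · have := hcS hX.1 hX.2
        omega
      · have hle : crossings p L x z A + crossings p L z y B ≤ 1 := by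
          unfold crossings
          split_ifs <;> simp_all
        omega
    nlinarith
  · push Not at hz
    have e1 : crossings p L x z A = 0 := if_neg (not_crosses_of_forall_ne hz)
    have e2 : crossings p L z y B = 0 := if_neg fun h => not_crosses_of_forall_ne hz h.symm
    have e3 : visits p L {z} = 0 := visits_eq_zero hz
    have hends := endsIn_add_le (p := p) (L := L) hAB hAS hBS
    rw [e1] at hA
    rw [e2] at hB
    have : (endsIn p L A + endsIn p L B) * M ≤ (endsIn p L S + crossings p L x y S) * N :=
      Nat.mul_le_mul (by omega) (by omega)
    nlinarith

theorem visits_parallel_le (hp : Set.InjOn p (Set.Iic L)) (hAC : ∀ v ∈ A, v ∉ C)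
    (hS : ∀ v, v ∈ S ↔ v ∈ A ∨ v ∈ C) {N : ℕ}
    (hA : visits p L A ≤ (endsIn p L A + crossings p L x y A) * N)
    (hC : visits p L C ≤ (endsIn p L C + crossings p L x y C) * N) :
    visits p L S ≤ (endsIn p L S + crossings p L x y S) * N := by
  have hAS : ∀ v ∈ A, v ∈ S := fun v hv => (hS v).2 (.inl hv)
  have hCS : ∀ v ∈ C, v ∈ S := fun v hv => (hS v).2 (.inr hv)
  have h1 := endsIn_add_le (p := p) (L := L) hAC hAS hCS
  have h2 := crossings_add_le (x := x) (y := y) hp hAC hAS hCS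
  have h3 := visits_union_le (p := p) (L := L) (fun v => (hS v).1)
  have : ((endsIn p L A + crossings p L x y A) + (endsIn p L C + crossings p L x y C)) * N ≤
      (endsIn p L S + crossings p L x y S) * N := Nat.mul_le_mul_right _ (by omega)
  nlinarith

end SimpleGraph
-- The main induction and the bound
namespace SimpleGraph

/-- Along a `2`-tree containing the `2`-connected graph `G`, a path can visit `S` only as often as
the induced paths running inside `S` towards `x` and `y` allow. -/
theorem TwoTreeOn.exists_visits_le {V : Type u} {G : SimpleGraph V}
    (hconn : ∀ v, (G.induce {v}ᶜ).Connected) {p : ℕ → V} {L : ℕ} (hp : Set.InjOn p (Set.Iic L))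
    (hadj : ∀ i < L, G.Adj (p i) (p (i + 1))) {x y : V} {S : Set V} {E : Set (Sym2 V)}
    (h : TwoTreeOn x y S E) (hE : ∀ a ∈ S, ∀ b, G.Adj a b → s(a, b) ∈ E) :
    ∃ k d e, k ≤ d + e ∧ G.HasInducedPathTo x S d ∧ G.HasInducedPathTo y S e ∧
      visits p L S ≤ (endsIn p L S + crossings p L x y S) * (2 ^ k - 1) := by
  induction h with
  | @edge x y h =>
    refine ⟨0, 0, 0, le_rfl, ⟨fun _ => x, ?_, rfl, by simp⟩, ⟨fun _ => y, ?_, rfl, by simp⟩, ?_⟩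
    · exact ⟨fun i j _ _ => by omega, fun i j _ _ => by omega⟩
    · exact ⟨fun i j _ _ => by omega, fun i j _ _ => by omega⟩
    · rw [visits_eq_zero (by simp)]
      exact Nat.zero_le _
  | @triangle x y z A B C S E₁ E₂ E₃ E hA hB hC hz hx hy hAB hAC hBC hS hE' ihA ihB ihC =>
    obtain ⟨hxz, hxA, hzA⟩ := hA.ne_and_notMem
    obtain ⟨hzy, hzB, hyB⟩ := hB.ne_and_notMem
    obtain ⟨hxy, hxC, hyC⟩ := hC.ne_and_notMem
    have mA : ∀ a b, s(a, b) ∈ E₁ → a ∈ A ∨ a = x ∨ a = z := fun a b => hA.mem_of_mem_edges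
    have mB : ∀ a b, s(a, b) ∈ E₂ → a ∈ B ∨ a = z ∨ a = y := fun a b => hB.mem_of_mem_edges
    have mC : ∀ a b, s(a, b) ∈ E₃ → a ∈ C ∨ a = x ∨ a = y := fun a b => hC.mem_of_mem_edges
    have key : ∀ a ∈ S, ∀ b, G.Adj a b → s(a, b) ∈ E₁ ∨ s(a, b) ∈ E₂ ∨ s(a, b) ∈ E₃ :=
      fun a ha b hab => (hE' _).1 (hE a ha b hab)
    have sA : ∀ v ∈ A, v ∈ S := fun v hv => (hS v).2 (.inr (.inl hv))
    have sB : ∀ v ∈ B, v ∈ S := fun v hv => (hS v).2 (.inr (.inr (.inl hv)))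
    have sC : ∀ v ∈ C, v ∈ S := fun v hv => (hS v).2 (.inr (.inr (.inr hv)))
    have eA : ∀ a ∈ A, ∀ b, G.Adj a b → s(a, b) ∈ E₁ := fun a ha b hab => by
      have h1 := key a (sA a ha) b hab
      have h2 := mB a b
      have h3 := mC a b
      grind
    have eB : ∀ a ∈ B, ∀ b, G.Adj a b → s(a, b) ∈ E₂ := fun a ha b hab => by
      have h1 := key a (sB a ha) b hab
      have h2 := mA a b
      have h3 := mC a b
      grind
    have eC : ∀ a ∈ C, ∀ b, G.Adj a b → s(a, b) ∈ E₃ := fun a ha b hab => by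
      have h1 := key a (sC a ha) b hab
      have h2 := mA a b
      have h3 := mB a b
      grind
    have nA : ∀ a ∈ A, ∀ b, G.Adj a b → b ∈ A ∨ b = x ∨ b = z := fun a ha b hab =>
      mA b a (Sym2.eq_swap ▸ eA a ha b hab)
    have nB : ∀ a ∈ B, ∀ b, G.Adj a b → b ∈ B ∨ b = z ∨ b = y := fun a ha b hab =>
      mB b a (Sym2.eq_swap ▸ eB a ha b hab)
    have nz : ∀ b, G.Adj z b → b ∈ A ∨ b = x ∨ b ∈ B ∨ b = y := fun b hzb => by
      have hne := hzb.ne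
      rcases key z ((hS z).2 (.inl rfl)) b hzb with h | h | h
      · have := mA b z (Sym2.eq_swap ▸ h)
        grind
      · have := mB b z (Sym2.eq_swap ▸ h)
        grind
      · have := mC z b h
        grind
    obtain ⟨kA, dA, eA', hkA, hdA, heA, hcA⟩ := ihA eA
    obtain ⟨kB, dB, eB', hkB, hdB, heB, hcB⟩ := ihB eB
    obtain ⟨kC, dC, eC', hkC, hdC, heC, hcC⟩ := ihC eC
    obtain ⟨fA, hfA, hpA⟩ := HasInducedPathTo.extend (S := S) (hconn x) hxz.symm hxy.symm hzy.symm
      nA nz nB hy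
      (fun v hv => hv.elim (fun h => (hS v).2 (.inl h)) (Or.rec (sA v) (sB v))) heA
    obtain ⟨fB, hfB, hpB⟩ := HasInducedPathTo.extend (S := S) (hconn y) hzy hxy hxz
      (fun a ha b hab => (nB a ha b hab).imp_right Or.symm)
      (fun b hb => by have := nz b hb; grind only)
      (fun a ha b hab => (nA a ha b hab).imp_right Or.symm)
      hx (fun v hv => hv.elim (fun h => (hS v).2 (.inl h)) (Or.rec (sB v) (sA v))) hdB
    have hcount : ∀ k, kA + 1 ≤ k → kB + 1 ≤ k → kC ≤ k →
        visits p L S ≤ (endsIn p L S + crossings p L x y S) * (2 ^ k - 1) := by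
      intro k h1 h2 h3
      obtain ⟨l, rfl⟩ : ∃ l, k = l + 1 := ⟨k - 1, by omega⟩
      have pow_le : ∀ {a b : ℕ}, a ≤ b → 2 ^ a - 1 ≤ 2 ^ b - 1 := fun hab =>
        Nat.sub_le_sub_right (Nat.pow_le_pow_right (by norm_num) hab) 1
      have hT : ∀ v, v ∈ ({v | v = z ∨ v ∈ A ∨ v ∈ B} : Set V) ↔ v = z ∨ v ∈ A ∨ v ∈ B :=
        fun v => Iff.rfl
      refine visits_parallel_le (A := {v | v = z ∨ v ∈ A ∨ v ∈ B}) (C := C) hp ?_ ?_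
        (visits_series_le (G := G) (M := 2 ^ l - 1) hp hadj ?_ hT hAB ?_ ?_ ?_) ?_
      · rintro v (rfl | h | h)
        · exact hz
        · exact hAC v h
        · exact hBC v h
      · intro v
        rw [hS, hT, or_assoc, or_assoc]
      · rintro a (rfl | h | h) b hab
        · have := nz b hab; rw [hT]; grind only
        · have := nA a h b hab; rw [hT]; grind only
        · have := nB a h b hab; rw [hT]; grind only
      · have := Nat.one_le_two_pow (n := l)
        rw [pow_succ]
        omega
      · exact hcA.trans (Nat.mul_le_mul_left _ (pow_le (by omega)))
      · exact hcB.trans (Nat.mul_le_mul_left _ (pow_le (by omega)))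
      · exact hcC.trans (Nat.mul_le_mul_left _ (pow_le (by omega)))
    -- Keep the pair of paths from the piece attaining the maximum: for `A` or `B` one of the two
    -- has been extended past `z`, for `C` both are inherited.
    by_cases h1 : kB ≤ kA ∧ kC ≤ kA + 1
    · exact ⟨kA + 1, dA, fA, by omega, hdA.mono sA, hpA, hcount _ (by omega) (by omega) (by omega)⟩
    · by_cases h2 : kC ≤ kB + 1
      · exact ⟨kB + 1, fB, eB', by omega, hpB, heB.mono sB,
          hcount _ (by omega) (by omega) (by omega)⟩
      · exact ⟨kC, dC, eC', hkC, hdC.mono sC, heC.mono sC,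
          hcount _ (by omega) (by omega) (by omega)⟩

theorem HasInducedPathTo.hasInducedPathOfSize {V : Type u} {G : SimpleGraph V} {x : V} {S : Set V}
    {d : ℕ} (h : G.HasInducedPathTo x S d) : G.HasInducedPathOfSize (d + 1) :=
  let ⟨_, h, _, _⟩ := h
  h.hasInducedPathOfSize

theorem exists_hasInducedPathOfSize {V : Type u} {G : SimpleGraph V} (hconn : G.IsTwoConnected)
    (hpartial : G.IsPartialKTree 2) {n : ℕ} (hpath : G.HasPathOfSize n) :
    ∃ m k, k + 2 ≤ 2 * m ∧ n ≤ 3 * 2 ^ k ∧ G.HasInducedPathOfSize m := by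
  obtain ⟨W, H, hH, ⟨f⟩⟩ := hpartial
  have hV : Nontrivial V := by
    rw [← ENat.one_lt_card_iff_nontrivial]
    exact lt_of_lt_of_le (by norm_num) hconn.1
  obtain ⟨x, y, S, E, hT, hmem, hE⟩ := hH.exists_twoTreeOn f f.injective hV
  obtain ⟨a, b, w, hw, rfl⟩ := hpath
  have hinj : Set.InjOn w.getVert (Set.Iic w.length) := hw.getVert_injOn
  obtain ⟨k, d, e, hk, hd, he, hc⟩ := hT.exists_visits_le hconn.2.2 hinj
    (fun i hi => w.adj_getVert_succ hi) (fun a _ b hab => hE a b (f.toHom.map_adj hab))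
  have htotal : w.length + 1 ≤ visits w.getVert w.length S + 2 := by
    have huniv : visits w.getVert w.length Set.univ = w.length + 1 := by simp [visits]
    have h1 := visits_union_le (p := w.getVert) (L := w.length) (S := Set.univ) (A := {x})
      (B := {y} ∪ S) fun v _ => hmem v
    have h2 := visits_union_le (p := w.getVert) (L := w.length) (S := {y} ∪ S) (A := {y})
      (B := S) fun v hv => hv
    have hx := visits_singleton_le (z := x) hinj
    have hy := visits_singleton_le (z := y) hinj
    omega
  -- The factor 3 is two ends plus one crossing.
  have hle : visits w.getVert w.length S ≤ 3 * (2 ^ k - 1) := by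
    refine hc.trans (Nat.mul_le_mul_right _ ?_)
    unfold endsIn crossings
    split_ifs <;> simp
  have hpos := Nat.one_le_two_pow (n := k)
  rcases le_total d e with h | h
  · exact ⟨e + 1, k, by omega, by omega, he.hasInducedPathOfSize⟩
  · exact ⟨d + 1, k, by omega, by omega, hd.hasInducedPathOfSize⟩

end SimpleGraph

theorem theorem2p4 {V : Type u} (G : SimpleGraph V) (hconn : G.IsTwoConnected)
    (hpartial : G.IsPartialKTree 2) (n : ℕ) (hn : 4 ≤ n) (hpath : G.HasPathOfSize n) :
    ∃ m : ℕ, Real.logb 2 ((n : ℝ) - 3) / 2 ≤ (m : ℝ) ∧ G.HasInducedPathOfSize m := by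
  obtain ⟨m, k, hk, hle, hm⟩ := SimpleGraph.exists_hasInducedPathOfSize hconn hpartial hpath
  refine ⟨m, ?_, hm⟩
  have hn' : (4 : ℝ) ≤ n := by exact_mod_cast hn
  -- Here `3 * 2 ^ k` is relaxed to `2 ^ (k + 2)`.
  have hpow : (n : ℝ) - 3 ≤ (2 : ℝ) ^ (2 * m) := by
    have h1 : (n : ℝ) ≤ 3 * 2 ^ k := by exact_mod_cast hle
    have h2 : (2 : ℝ) ^ (k + 2) ≤ 2 ^ (2 * m) := pow_le_pow_right₀ (by norm_num) hk
    have h3 : (0 : ℝ) < 2 ^ k := by positivity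
    rw [pow_add] at h2
    linarith
  have hlog : Real.logb 2 ((n : ℝ) - 3) ≤ ((2 * m : ℕ) : ℝ) := by
    rw [Real.logb_le_iff_le_rpow (by norm_num) (by linarith), Real.rpow_natCast]
    exact hpow
  push_cast at hlog
  linarith
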